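/- Let $1\le p\le\infty$ and let $\mathbb T$ be the circle with its normalised Haar measure. A function $\phi:\mathbb Z\to\mathbb C$ is called a Fourier multiplier on $L_p(\mathbb T)$ if there is a (necessarily unique) bounded linear operator $M_\phi$ on $L_p(\mathbb T)$ such that $\widehat{M_\phi f}(m)=\phi(m)\hat f(m)$ for all $f\in L_p(\mathbb T)$ and $m\in\mathbb Z$. Write $\|M_\phi\|$ for its operator norm on $L_p(\mathbb T)$ and $$\|M_\phi\|_{cb}=\sup_{k\ge 1}\big\|\mathrm{Id}_{S_p^k}\otimes M_\phi: L_p(\mathbb T;S_p^k)\to L_p(\mathbb T;S_p^k)\big\|\in[0,\infty],$$ where $S_p^k$ is the space of complex $k\times k$ matrices with the Schatten $p$-norm (the operator norm if $p=\infty$), for its completely bounded norm. Let $\phi:\mathbb Z\to\mathbb C$ be a Fourier multiplier on $L_p(\mathbb T)$. Then there exists a sequence $(\phi_n)_{n}$ of periodic functions $\phi_n:\mathbb Z\to\mathbb C$ (the period may depend on $n$), each of which is a Fourier multiplier on $L_p(\mathbb T)$, such that $\phi_n(m)\to\phi(m)$ as $n\to\infty$ for every $m\in\mathbb Z$, and,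 for every $n$, $$\|M_{\phi_n}\|\le\|M_\phi\|\qquad\text{and}\qquad \|M_{\phi_n}\|_{cb}\le\|M_\phi\|_{cb}.$$ -/

import Mathlib

open MeasureTheory AddCircle Filter Topology
open scoped ENNReal

/-- The complex space `L_p(𝕋)`, for the circle `𝕋 = ℝ/ℤ` with its normalised Haar measure. The
monomial `z ^ m` is `fourier m : t ↦ exp (2 π i m t)`. -/
abbrev LpCircle (p : ℝ≥0∞) : Type :=
  Lp ℂ p (haarAddCircle : Measure UnitAddCircle)

/-- `M` is the Fourier multiplier `M_φ` on `L_p(𝕋)`: the bounded linear operator that multiplies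
the `m`-th Fourier coefficient by `φ m`. Such an `M` is unique, as Fourier coefficients determine
elements of `L_p(𝕋)`. For `p < ∞` the condition is equivalent to `M (z ^ m) = φ m • z ^ m` for all
`m`, by density of the trigonometric polynomials. For `p = ∞` it singles out the weak-* continuous
extension. -/
def IsFourierMultiplier {p : ℝ≥0∞} [Fact (1 ≤ p)] (φ : ℤ → ℂ)
    (M : LpCircle p →L[ℂ] LpCircle p) : Prop :=
  ∀ (f : LpCircle p) (m : ℤ), fourierCoeff (M f) m = φ m * fourierCoeff f m

/-- The Schatten norm `‖A‖_{S_p^k}` of a complex `k × k` matrix: the `ℓ_p`-norm of its singular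
values. For `p = ∞` it is the operator norm. -/
noncomputable def schattenNorm (p : ℝ≥0∞) {k : ℕ} (A : Matrix (Fin k) (Fin k) ℂ) : ℝ :=
  ‖WithLp.toLp p (fun i : Fin k ↦ (Matrix.toEuclideanLin A).singularValues i)‖

/-- The norm of a matrix `F = (F i j)` with entries in `L_p(𝕋)` as an element of
`S_p^k[L_p(𝕋)] = L_p(𝕋; S_p^k)`, the noncommutative `L_p`-space of `M_k(ℂ) ⊗ L_∞(𝕋)`. -/
noncomputable def matrixLpNorm {p : ℝ≥0∞} {k : ℕ}
    (F : Matrix (Fin k) (Fin k) (LpCircle p)) : ℝ≥0∞ :=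
  eLpNorm (fun t : UnitAddCircle ↦ schattenNorm p (Matrix.of fun i j ↦ F i j t)) p haarAddCircle

/-- The norm of the amplification `Id ⊗ M` on `S_p^k[L_p(𝕋)]`, which applies `M` entrywise. -/
noncomputable def amplificationNorm {p : ℝ≥0∞} [Fact (1 ≤ p)] (k : ℕ)
    (M : LpCircle p →L[ℂ] LpCircle p) : ℝ≥0∞ :=
  sInf {C : ℝ≥0∞ | ∀ F : Matrix (Fin k) (Fin k) (LpCircle p),
    matrixLpNorm (F.map M) ≤ C * matrixLpNorm F}

/-- The completely bounded norm of a bounded operator on `L_p(𝕋)`, with value `∞` if the operator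
is not completely bounded. -/
noncomputable def cbNorm {p : ℝ≥0∞} [Fact (1 ≤ p)] (M : LpCircle p →L[ℂ] LpCircle p) : ℝ≥0∞ :=
  ⨆ k : ℕ, amplificationNorm k M

/-!
Fix `N ≥ 1` and let `c : 𝕋 → ℤ/N` send a point to the index of the arc `[j/N, (j+1)/N)` that
contains it. The periodic multiplier is obtained by restricting `M` to the functions that are
constant on the arcs, and averaging the resulting operator on functions on `ℤ/N` over translations.
This gives an operator `T` of convolution with a measure on the `N`-th roots of unity, so that its
multiplier `ψ` is `N`-periodic. Explicitly (`coeFn_cellConvolution_eq_integral`), for a.e. `t`,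
`T f t = ∫ M (S_{t - c(x)/N} f) x dx`, where `S_t f x = f (t + c(x)/N)`.

**Norms.** The same formula holds for functions with values in a finite-dimensional space with a
seminorm `ν`. Jensen's inequality in `x`, Tonelli's theorem and invariance of the Haar measure
under `t ↦ t + c(x)/N` bound `‖ν (T F)‖_p` by the norm of `ν (M (S_t F) x)` in `L_p(dt dx)`, hence
by `C` times the norm of `ν (S_t F x)`, where `C` bounds the amplification of `M`. By invariance
again, the latter norm is `‖ν F‖_p`. This is `eLpNorm_seminorm_cellConvolution_le`. The modulus on
`ℂ` gives the operator norm, and the Schatten norms give the completely bounded norm. That the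
Schatten norm is a seminorm (`schattenSeminorm`) follows from its description as the maximum of
`‖(⟪u i, A (v i)⟫)_i‖_{ℓ_p}` over pairs of orthonormal bases.

**Convergence.** Let `s` be the step function `x ↦ exp (2 π i m c(x)/N)`. Then `ψ m = ∫ s̄ M s`
(`cellSymbol_eq_integral`), and `s` tends uniformly to `exp (2 π i m x)` as `N → ∞`. As `M` is the
multiplier `M_φ`, the integral tends to `φ m` (`norm_cellSymbol_sub_le`).
-/

/-! ### The Schatten norm -/

/-- Singular value decomposition, with `v` an orthonormal eigenbasis of `A† A`. -/
theorem LinearMap.exists_orthonormalBasis_apply_eq_singularValues_smul {E : Type*}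
    [NormedAddCommGroup E] [InnerProductSpace ℂ E] [FiniteDimensional ℂ E] {k : ℕ}
    (hk : Module.finrank ℂ E = k) (A : E →ₗ[ℂ] E) :
    ∃ u v : OrthonormalBasis (Fin k) ℂ E, ∀ i, A (v i) = (A.singularValues i : ℂ) • u i := by
  set v := A.isSymmetric_adjoint_comp_self.eigenvectorBasis hk with hv
  have hA : ∀ i j, inner ℂ (A (v i)) (A (v j)) =
      if i = j then ((A.singularValues i : ℂ)) ^ 2 else 0 := by
    intro i j
    have h1 : (LinearMap.adjoint A ∘ₗ A) (v j) =
        ((A.isSymmetric_adjoint_comp_self.eigenvalues hk j : ℝ) : ℂ) • v j :=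
      A.isSymmetric_adjoint_comp_self.apply_eigenvectorBasis hk j
    rw [← LinearMap.adjoint_inner_right, ← LinearMap.comp_apply, h1, inner_smul_right,
      orthonormal_iff_ite.1 v.orthonormal i j, ← A.sq_singularValues_fin hk j]
    split_ifs with h <;> simp [h]
  set s : Set (Fin k) := {i | A.singularValues i ≠ 0}
  set w : Fin k → E := fun i ↦ (A.singularValues i : ℂ)⁻¹ • A (v i)
  have hw : Orthonormal ℂ (s.domRestrict w) := by
    rw [orthonormal_iff_ite]
    rintro ⟨i, hi⟩ ⟨j, hj⟩
    have hi' : (A.singularValues i : ℂ) ≠ 0 := by exact_mod_cast hi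
    simp only [Set.domRestrict_apply, w, inner_smul_left, inner_smul_right, hA, Subtype.mk.injEq]
    split_ifs with h
    · subst h
      simp only [map_inv₀, Complex.conj_ofReal]
      field_simp
    · simp
  -- The `u i` with zero singular value are arbitrary: both sides vanish for those indices.
  obtain ⟨u, hu⟩ := hw.exists_orthonormalBasis_extension_of_card_eq (by simpa using hk)
  refine ⟨u, v, fun i ↦ ?_⟩
  by_cases h : A.singularValues i = 0
  · have := hA i i
    simp only [h, if_true] at this
    simpa [h] using this
  · rw [hu i h]
    have hi' : (A.singularValues i : ℂ) ≠ 0 := by exact_mod_cast h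
    simp [w, smul_smul, hi']

/-- A doubly stochastic matrix does not increase the `ℓ_p`-norm, by Jensen's inequality in each
row. -/
theorem PiLp.norm_toLp_le_of_doublyStochastic {ι 𝕜 : Type*} [Fintype ι]
    [NormedAddCommGroup 𝕜] {p : ℝ≥0∞}
    (hp : 1 ≤ p) {w : ι → ι → ℝ} (hw : ∀ i j, 0 ≤ w i j) (hrow : ∀ i, ∑ j, w i j = 1)
    (hcol : ∀ j, ∑ i, w i j = 1) {x : ι → 𝕜} {y : ι → ℝ}
    (hxy : ∀ i, ‖x i‖ ≤ ∑ j, w i j * |y j|) :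
    ‖WithLp.toLp p x‖ ≤ ‖WithLp.toLp p y‖ := by
  rcases eq_or_ne p ∞ with rfl | hp'
  · rw [PiLp.norm_eq_ciSup, PiLp.norm_eq_ciSup]
    refine Real.iSup_le (fun i ↦ ?_) (Real.iSup_nonneg fun i ↦ norm_nonneg _)
    calc ‖x i‖ ≤ ∑ j, w i j * |y j| := hxy i
      _ ≤ ∑ j, w i j * ⨆ j, ‖y j‖ := by
        gcongr with j
        · exact hw i j
        · exact le_ciSup (f := fun j ↦ ‖y j‖) (Set.finite_range _).bddAbove j
      _ = _ := by rw [← Finset.sum_mul, hrow, one_mul]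
  · have h1 : 1 ≤ p.toReal := by
      rw [← ENNReal.toReal_one]
      exact ENNReal.toReal_mono hp' hp
    have h0 : 0 < p.toReal := by linarith
    rw [PiLp.norm_eq_sum h0, PiLp.norm_eq_sum h0]
    apply Real.rpow_le_rpow (by positivity) _ (by positivity)
    calc ∑ i, ‖x i‖ ^ p.toReal ≤ ∑ i, ∑ j, w i j * |y j| ^ p.toReal := by
          gcongr with i
          refine (Real.rpow_le_rpow (norm_nonneg _) (hxy i) h0.le).trans ?_
          exact Real.rpow_arith_mean_le_arith_mean_rpow _ _ _ (fun j _ ↦ hw i j) (hrow i)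
            (fun j _ ↦ abs_nonneg _) h1
      _ = ∑ j, ‖y j‖ ^ p.toReal := by
          rw [Finset.sum_comm]
          simp_rw [← Finset.sum_mul, hcol, one_mul, Real.norm_eq_abs]

/-- The diagonal of an operator with respect to any two orthonormal bases has `ℓ_p`-norm at most
that of the sequence of singular values: the moduli of the diagonal entries are dominated by the
image of the singular values under a doubly stochastic matrix. -/
theorem LinearMap.norm_toLp_inner_le_norm_singularValues {E : Type*}
    [NormedAddCommGroup E] [InnerProductSpace ℂ E] [FiniteDimensional ℂ E] {k : ℕ}
    {p : ℝ≥0∞} (hp : 1 ≤ p) (A : E →ₗ[ℂ] E) (u v : OrthonormalBasis (Fin k) ℂ E) :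
    ‖WithLp.toLp p (fun i ↦ inner ℂ (u i) (A (v i)))‖ ≤
      ‖WithLp.toLp p (fun i : Fin k ↦ A.singularValues i)‖ := by
  obtain ⟨x, y, hxy⟩ := A.exists_orthonormalBasis_apply_eq_singularValues_smul
    (by simpa using Module.finrank_eq_card_basis u.toBasis)
  refine PiLp.norm_toLp_le_of_doublyStochastic hp
    (w := fun i j ↦ (‖inner ℂ (x j) (u i)‖ ^ 2 + ‖inner ℂ (y j) (v i)‖ ^ 2) / 2)
    (fun i j ↦ by positivity) (fun i ↦ ?_) (fun j ↦ ?_) (fun i ↦ ?_)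
  · rw [← Finset.sum_div, Finset.sum_add_distrib, x.sum_sq_norm_inner_right,
      y.sum_sq_norm_inner_right]
    simp
  · rw [← Finset.sum_div, Finset.sum_add_distrib, u.sum_sq_norm_inner_left,
      v.sum_sq_norm_inner_left]
    simp
  · have h : A (v i) = ∑ j, (inner ℂ (y j) (v i) * A.singularValues j) • x j := by
      conv_lhs => rw [← y.sum_repr' (v i)]
      simp_rw [map_sum, map_smul, hxy, smul_smul]
    rw [h, inner_sum]
    refine (norm_sum_le _ _).trans (Finset.sum_le_sum fun j _ ↦ ?_)
    rw [inner_smul_right, norm_mul, norm_mul, norm_inner_symm (u i), Complex.norm_real,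
      Real.norm_eq_abs]
    have := two_mul_le_add_sq ‖inner ℂ (x j) (u i)‖ ‖inner ℂ (y j) (v i)‖
    nlinarith [abs_nonneg (A.singularValues j)]

theorem norm_toLp_inner_le_schattenNorm {p : ℝ≥0∞} (hp : 1 ≤ p) {k : ℕ}
    (A : Matrix (Fin k) (Fin k) ℂ) (u v : OrthonormalBasis (Fin k) ℂ (EuclideanSpace ℂ (Fin k))) :
    ‖WithLp.toLp p (fun i ↦ inner ℂ (u i) (Matrix.toEuclideanLin A (v i)))‖ ≤
      schattenNorm p A :=
  LinearMap.norm_toLp_inner_le_norm_singularValues hp _ u v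

/-- The bound `norm_toLp_inner_le_schattenNorm` is attained at the bases of a singular value
decomposition. -/
theorem exists_norm_toLp_inner_eq_schattenNorm (p : ℝ≥0∞) [Fact (1 ≤ p)] {k : ℕ}
    (A : Matrix (Fin k) (Fin k) ℂ) :
    ∃ u v : OrthonormalBasis (Fin k) ℂ (EuclideanSpace ℂ (Fin k)),
      ‖WithLp.toLp p (fun i ↦ inner ℂ (u i) (Matrix.toEuclideanLin A (v i)))‖ =
        schattenNorm p A := by
  obtain ⟨u, v, h⟩ := (Matrix.toEuclideanLin
    A).exists_orthonormalBasis_apply_eq_singularValues_smul (k := k) (by simp)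
  refine ⟨u, v, ?_⟩
  rw [schattenNorm]
  simp_rw [h, inner_smul_right, inner_self_eq_norm_sq_to_K, u.norm_eq_one]
  rcases eq_or_ne p ∞ with rfl | hp
  · simp [PiLp.norm_eq_ciSup]
  · have h0 : 0 < p.toReal := ENNReal.toReal_pos (zero_lt_one.trans_le Fact.out).ne' hp
    simp [PiLp.norm_eq_sum h0]

/-- The Schatten norm as a seminorm. The triangle inequality holds because `‖A‖_{S_p^k}` is the
maximum, over pairs of orthonormal bases `u`, `v`, of the `ℓ_p`-norm of `i ↦ ⟪u i, A (v i)⟫`. -/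
noncomputable def schattenSeminorm (p : ℝ≥0∞) [Fact (1 ≤ p)] (k : ℕ) :
    Seminorm ℂ (Matrix (Fin k) (Fin k) ℂ) :=
  Seminorm.ofSMulLE (schattenNorm p)
    (by
      obtain ⟨u, v, h⟩ := exists_norm_toLp_inner_eq_schattenNorm p
        (0 : Matrix (Fin k) (Fin k) ℂ)
      rw [← h]
      simp only [map_zero, LinearMap.zero_apply, inner_zero_right]
      exact norm_zero (E := PiLp p fun _ : Fin k ↦ ℂ))
    (fun A B ↦ by
      obtain ⟨u, v, h⟩ := exists_norm_toLp_inner_eq_schattenNorm p (A + B)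
      rw [← h]
      simp only [map_add, LinearMap.add_apply, inner_add_right]
      exact (norm_add_le (WithLp.toLp p fun i ↦ inner ℂ (u i) (Matrix.toEuclideanLin A (v i)))
        (WithLp.toLp p fun i ↦ inner ℂ (u i) (Matrix.toEuclideanLin B (v i)))).trans
        (add_le_add (norm_toLp_inner_le_schattenNorm Fact.out A u v)
          (norm_toLp_inner_le_schattenNorm Fact.out B u v)))
    (fun c A ↦ by
      obtain ⟨u, v, h⟩ := exists_norm_toLp_inner_eq_schattenNorm p (c • A)
      rw [← h]
      simp only [map_smul, LinearMap.smul_apply, inner_smul_right]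
      exact (norm_smul_le c
        (WithLp.toLp p fun i ↦ inner ℂ (u i) (Matrix.toEuclideanLin A (v i)))).trans
        (mul_le_mul_of_nonneg_left (norm_toLp_inner_le_schattenNorm Fact.out A u v)
          (norm_nonneg c)))

/-! ### Jensen's inequality for seminorms -/

theorem Seminorm.continuous_of_finiteDimensional {E : Type*} [NormedAddCommGroup E]
    [NormedSpace ℂ E] [FiniteDimensional ℂ E] (ν : Seminorm ℂ E) : Continuous ν := by
  have : FiniteDimensional ℝ E := FiniteDimensional.complexToReal E
  have := (Seminorm.convexOn (ν.restrictScalars ℝ)).locallyLipschitz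
  exact this.continuous

/-- Jensen's inequality, in `L_1` and then from `L_1` to `L_p` on a probability space. -/
theorem Seminorm.enorm_integral_le_eLpNorm {α E : Type*} [MeasurableSpace α] {μ : Measure α}
    [IsProbabilityMeasure μ] [NormedAddCommGroup E] [NormedSpace ℂ E] [FiniteDimensional ℂ E]
    (ν : Seminorm ℂ E) {p : ℝ≥0∞} (hp : 1 ≤ p) {G : α → E} (hG : Integrable G μ) :
    ‖ν (∫ x, G x ∂μ)‖ₑ ≤ eLpNorm (fun x ↦ ν (G x)) p μ := by
  have hν := ν.continuous_of_finiteDimensional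
  obtain ⟨C, -, hC⟩ := ν.bound_of_continuous_normedSpace hν
  have hm : AEStronglyMeasurable (fun x ↦ ν (G x)) μ :=
    hν.comp_aestronglyMeasurable hG.aestronglyMeasurable
  have hi : Integrable (fun x ↦ ν (G x)) μ := by
    refine (hG.norm.const_mul C).mono' hm (ae_of_all _ fun x ↦ ?_)
    rw [Real.norm_of_nonneg (apply_nonneg ν _)]
    exact hC _
  have hJ : ν (∫ x, G x ∂μ) ≤ ∫ x, ν (G x) ∂μ :=
    (Seminorm.convexOn (ν.restrictScalars ℝ)).map_integral_le hν.continuousOn isClosed_univ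
      (by simp) hG hi
  calc ‖ν (∫ x, G x ∂μ)‖ₑ ≤ ‖∫ x, ν (G x) ∂μ‖ₑ := by
        rw [Real.enorm_of_nonneg (apply_nonneg ν _),
          Real.enorm_of_nonneg (integral_nonneg fun x ↦ apply_nonneg ν _)]
        exact ENNReal.ofReal_le_ofReal hJ
    _ ≤ ∫⁻ x, ‖ν (G x)‖ₑ ∂μ := enorm_integral_le_lintegral_enorm _
    _ = eLpNorm (fun x ↦ ν (G x)) 1 μ := eLpNorm_one_eq_lintegral_enorm.symm
    _ ≤ eLpNorm (fun x ↦ ν (G x)) p μ := eLpNorm_le_eLpNorm_of_exponent_le hp hm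

/-! ### Averaging along the translations by roots of unity -/

section Averaging

variable {N : ℕ} [NeZero N] {c : UnitAddCircle → ZMod N}

theorem measurable_apply_comp_fiber {β : Type*} [MeasurableSpace β] (hc : Measurable c)
    {g : ZMod N → UnitAddCircle → β} (hg : ∀ i, Measurable (g i)) :
    Measurable fun x ↦ g (c x) x :=
  (measurable_from_prod_countable_left (f := fun z : UnitAddCircle × ZMod N ↦ g z.2 z.1)
    hg).comp (measurable_id.prodMk hc)

theorem integrable_apply_comp_fiber (hc : Measurable c)
    {g : ZMod N → UnitAddCircle → ℂ} (hg : ∀ i, Measurable (g i))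
    (hi : ∀ i, Integrable (g i) haarAddCircle) :
    Integrable (fun x ↦ g (c x) x) haarAddCircle := by
  refine (integrable_finsetSum Finset.univ fun i _ ↦ (hi i).norm).mono'
    (measurable_apply_comp_fiber hc hg).aestronglyMeasurable (ae_of_all _ fun x ↦ ?_)
  exact Finset.single_le_sum (f := fun i ↦ ‖g i x‖) (fun _ _ ↦ norm_nonneg _)
    (Finset.mem_univ (c x))

theorem lintegral_lintegral_translate_fiber (hc : Measurable c)
    (θ : ZMod N → UnitAddCircle) {φ : UnitAddCircle × UnitAddCircle → ℝ≥0∞} (hφ : Measurable φ) :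
    ∫⁻ t, ∫⁻ x, φ (t + θ (c x), x) ∂haarAddCircle ∂(haarAddCircle : Measure UnitAddCircle) =
      ∫⁻ t, ∫⁻ x, φ (t, x) ∂haarAddCircle ∂haarAddCircle := by
  have hθ : Measurable fun x ↦ θ (c x) := (measurable_of_countable θ).comp hc
  rw [lintegral_lintegral_swap, lintegral_lintegral_swap (f := fun t x ↦ φ (t, x))
    hφ.aemeasurable]
  · exact lintegral_congr fun x ↦ lintegral_add_right_eq_self (fun t ↦ φ (t, x)) _
  · exact (hφ.comp ((measurable_fst.add (hθ.comp measurable_snd)).prodMk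
      measurable_snd)).aemeasurable

/-- A mixed-norm inequality: if `w` is controlled by averages of `φ` over translates, and the
slices of `φ` are controlled by the samples of `v`, then `w` is controlled by `v`. For `p < ∞`
this is Tonelli's theorem and invariance of the Haar measure. For `p = ∞` it holds because there
are only finitely many translations. -/
theorem eLpNorm_le_of_translate_fiber (hc : Measurable c) (θ : ZMod N → UnitAddCircle)
    {p : ℝ≥0∞} (hp : p ≠ 0) {φ : UnitAddCircle × UnitAddCircle → ℝ} (hφ : Measurable φ)
    {v w : UnitAddCircle → ℝ} (hv : Measurable v) {C : ℝ≥0∞}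
    (hw : ∀ᵐ t ∂(haarAddCircle : Measure UnitAddCircle),
      ‖w t‖ₑ ≤ eLpNorm (fun x ↦ φ (t - θ (c x), x)) p haarAddCircle)
    (hφv : ∀ t, eLpNorm (fun x ↦ φ (t, x)) p haarAddCircle ≤
      C * eLpNorm (fun x ↦ v (t + θ (c x))) p haarAddCircle) :
    eLpNorm w p haarAddCircle ≤ C * eLpNorm v p haarAddCircle := by
  rcases eq_or_ne p ∞ with rfl | hp'
  · set D := eLpNorm v ∞ haarAddCircle with hD
    have hvD : ∀ᵐ t ∂(haarAddCircle : Measure UnitAddCircle), ‖v t‖ₑ ≤ D := by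
      rw [hD, eLpNorm_exponent_top]
      exact enorm_ae_le_eLpNormEssSup v _
    have hvD' : ∀ᵐ t ∂(haarAddCircle : Measure UnitAddCircle),
        ∀ i j, ‖v (t - θ i + θ j)‖ₑ ≤ D := by
      simp only [ae_all_iff]
      intro i j
      have h := (measurePreserving_add_right (haarAddCircle : Measure UnitAddCircle)
        (- θ i + θ j)).quasiMeasurePreserving.ae hvD
      filter_upwards [h] with t ht
      rwa [sub_eq_add_neg, add_assoc]
    rw [eLpNorm_exponent_top]
    refine eLpNormEssSup_le_of_ae_enorm_bound ?_
    filter_upwards [hw, hvD'] with t ht htv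
    refine ht.trans ?_
    rw [eLpNorm_exponent_top]
    refine eLpNormEssSup_le_of_ae_enorm_bound ?_
    have h : ∀ i, ∀ᵐ x ∂(haarAddCircle : Measure UnitAddCircle),
        ‖φ (t - θ i, x)‖ₑ ≤ C * D := by
      intro i
      have h1 := hφv (t - θ i)
      rw [eLpNorm_exponent_top, eLpNorm_exponent_top] at h1
      have h2 : eLpNormEssSup (fun x ↦ v (t - θ i + θ (c x))) haarAddCircle ≤ D :=
        eLpNormEssSup_le_of_ae_enorm_bound (ae_of_all _ fun x ↦ htv i (c x))
      filter_upwards [enorm_ae_le_eLpNormEssSup (fun x ↦ φ (t - θ i, x)) haarAddCircle] with x hx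
      exact hx.trans (h1.trans (by gcongr))
    filter_upwards [ae_all_iff.2 h] with x hx using hx (c x)
  · have h0 : 0 < p.toReal := ENNReal.toReal_pos hp hp'
    have key : ∀ g : UnitAddCircle → ℝ, eLpNorm g p haarAddCircle ^ p.toReal =
        ∫⁻ x, ‖g x‖ₑ ^ p.toReal ∂haarAddCircle := by
      intro g
      rw [eLpNorm_eq_lintegral_rpow_enorm_toReal hp hp', ← ENNReal.rpow_mul,
        one_div_mul_cancel h0.ne', ENNReal.rpow_one]
    have hφ' : Measurable fun z ↦ ‖φ z‖ₑ ^ p.toReal := hφ.enorm.pow_const _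
    have hv' : Measurable fun z : UnitAddCircle × UnitAddCircle ↦ ‖v z.1‖ₑ ^ p.toReal :=
      (hv.comp measurable_fst).enorm.pow_const _
    rw [← ENNReal.rpow_le_rpow_iff h0, ENNReal.mul_rpow_of_nonneg _ _ h0.le, key, key]
    calc ∫⁻ t, ‖w t‖ₑ ^ p.toReal ∂haarAddCircle
        ≤ ∫⁻ t, ∫⁻ x, ‖φ (t + -θ (c x), x)‖ₑ ^ p.toReal ∂haarAddCircle ∂haarAddCircle := by
          refine lintegral_mono_ae ?_
          filter_upwards [hw] with t ht
          simp_rw [← sub_eq_add_neg]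
          rw [← key fun x ↦ φ (t - θ (c x), x)]
          gcongr
      _ = ∫⁻ t, ∫⁻ x, ‖φ (t, x)‖ₑ ^ p.toReal ∂haarAddCircle ∂haarAddCircle :=
          lintegral_lintegral_translate_fiber hc (fun i ↦ - θ i) hφ'
      _ ≤ ∫⁻ t, C ^ p.toReal * ∫⁻ x, ‖v (t + θ (c x))‖ₑ ^ p.toReal
            ∂haarAddCircle ∂haarAddCircle := by
          refine lintegral_mono fun t ↦ ?_
          rw [← key fun x ↦ φ (t, x), ← key fun x ↦ v (t + θ (c x)),
            ← ENNReal.mul_rpow_of_nonneg _ _ h0.le]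
          exact ENNReal.rpow_le_rpow (hφv t) h0.le
      _ = C ^ p.toReal * ∫⁻ t, ∫⁻ x, ‖v (t + θ (c x))‖ₑ ^ p.toReal
            ∂haarAddCircle ∂haarAddCircle := by
          refine lintegral_const_mul _ (Measurable.lintegral_prod_right' (f := fun z ↦
            ‖v (z.1 + θ (c z.2))‖ₑ ^ p.toReal) ?_)
          have hθ : Measurable fun x ↦ θ (c x) := (measurable_of_countable θ).comp hc
          exact (hv.comp (measurable_fst.add (hθ.comp measurable_snd))).enorm.pow_const _
      _ = C ^ p.toReal * ∫⁻ t, ‖v t‖ₑ ^ p.toReal ∂haarAddCircle := by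
          rw [lintegral_lintegral_translate_fiber hc θ hv']
          simp

end Averaging

/-! ### Transference to the roots of unity -/

section Transference

theorem LpCircle.measurable {p : ℝ≥0∞} (f : LpCircle p) : Measurable f :=
  (Lp.stronglyMeasurable f).measurable

theorem LpCircle.integrable {p : ℝ≥0∞} [hp : Fact (1 ≤ p)] (f : LpCircle p) :
    Integrable f haarAddCircle :=
  (Lp.memLp f).integrable hp.out

theorem LpCircle.coeFn_sum_smul {p : ℝ≥0∞} {N : ℕ} [NeZero N] (a : ZMod N → ℂ)
    (g : ZMod N → LpCircle p) :
    (∑ j, a j • g j : LpCircle p) =ᵐ[haarAddCircle] fun x ↦ ∑ j, a j * g j x := by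
  filter_upwards [Lp.coeFn_fun_finsetSum Finset.univ fun j ↦ a j • g j,
    ae_all_iff.2 fun j ↦ Lp.coeFn_smul (a j) (g j)] with x h3 h4
  rw [h3]
  exact Finset.sum_congr rfl fun r _ ↦ h4 r

variable {p : ℝ≥0∞} [Fact (1 ≤ p)] {N : ℕ} [NeZero N] {c : UnitAddCircle → ZMod N}

/-- The indicator function of the cell `{x | c x = j}`. -/
noncomputable def cellIndicator (p : ℝ≥0∞) (hc : Measurable c) (j : ZMod N) : LpCircle p :=
  indicatorConstLp p (hc (measurableSet_singleton j)) (measure_ne_top _ _) (1 : ℂ)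

/-- Translation `f ↦ f (· + y)` on `L_p(𝕋)`. -/
noncomputable def translation (p : ℝ≥0∞) [Fact (1 ≤ p)] (y : UnitAddCircle) :
    LpCircle p →L[ℂ] LpCircle p :=
  (Lp.compMeasurePreservingₗᵢ ℂ (· + y)
    (measurePreserving_add_right haarAddCircle y)).toContinuousLinearMap

theorem coeFn_translation (y : UnitAddCircle) (f : LpCircle p) :
    translation p y f =ᵐ[haarAddCircle] fun t ↦ f (t + y) :=
  Lp.coeFn_compMeasurePreserving f (measurePreserving_add_right haarAddCircle y)

/-- The convolution kernel on `ℤ/N` obtained by restricting `M` to functions that are constant on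
the cells of `c`, and averaging over the translations of `ℤ/N`: the sum over `i` of the integrals
of `M 1_{c = i + r}` over the cells `{c = i}`. -/
noncomputable def cellKernel (M : LpCircle p →L[ℂ] LpCircle p) (hc : Measurable c)
    (r : ZMod N) : ℂ :=
  ∫ x, M (cellIndicator p hc (c x + r)) x ∂haarAddCircle

/-- The operator of convolution with the measure `∑ r, cellKernel M hc r • δ_{-r/N}`. -/
noncomputable def cellConvolution (M : LpCircle p →L[ℂ] LpCircle p) (hc : Measurable c) :
    LpCircle p →L[ℂ] LpCircle p :=
  ∑ r, cellKernel M hc r • translation p (ZMod.toAddCircle r)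

/-- The multiplier of `cellConvolution M hc`: the Fourier transform of its kernel on `ℤ/N`. -/
noncomputable def cellSymbol (M : LpCircle p →L[ℂ] LpCircle p) (hc : Measurable c) (m : ℤ) : ℂ :=
  ∑ r : ZMod N, cellKernel M hc r * fourier m (ZMod.toAddCircle r : UnitAddCircle)

theorem cellSymbol_periodic (M : LpCircle p →L[ℂ] LpCircle p) (hc : Measurable c) :
    Function.Periodic (cellSymbol M hc) (N : ℤ) := by
  intro m
  refine Finset.sum_congr rfl fun r _ ↦ ?_
  have h : (N : ℤ) • (ZMod.toAddCircle r : UnitAddCircle) = 0 := by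
    rw [← map_zsmul]
    simp
  rw [fourier_add, fourier_apply (n := (N : ℤ)), h]
  simp

theorem coeFn_cellConvolution (M : LpCircle p →L[ℂ] LpCircle p) (hc : Measurable c)
    (f : LpCircle p) :
    cellConvolution M hc f =ᵐ[haarAddCircle]
      fun t ↦ ∑ r, cellKernel M hc r * f (t + ZMod.toAddCircle r) := by
  have h1 : cellConvolution M hc f =
      ∑ r, cellKernel M hc r • translation p (ZMod.toAddCircle r) f := by
    simp [cellConvolution]
  rw [h1]
  have h2 : ∀ r : ZMod N, (cellKernel M hc r • translation p (ZMod.toAddCircle r) f : LpCircle p)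
      =ᵐ[haarAddCircle] fun t ↦ cellKernel M hc r * f (t + ZMod.toAddCircle r) := by
    intro r
    filter_upwards [Lp.coeFn_smul (cellKernel M hc r) (translation p (ZMod.toAddCircle r) f),
      coeFn_translation (ZMod.toAddCircle r) f] with t h3 h4
    rw [h3, Pi.smul_apply, h4, smul_eq_mul]
  filter_upwards [Lp.coeFn_fun_finsetSum Finset.univ
    fun r ↦ cellKernel M hc r • translation p (ZMod.toAddCircle r) f, ae_all_iff.2 h2] with t h3 h4
  rw [h3]
  exact Finset.sum_congr rfl fun r _ ↦ h4 r

theorem isFourierMultiplier_cellConvolution (M : LpCircle p →L[ℂ] LpCircle p)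
    (hc : Measurable c) : IsFourierMultiplier (cellSymbol M hc) (cellConvolution M hc) := by
  intro f m
  rw [fourierCoeff_congr_ae (coeFn_cellConvolution M hc f)]
  have hi : ∀ y : UnitAddCircle, Integrable (fun t ↦ f (t + y)) haarAddCircle := fun y ↦
    (measurePreserving_add_right haarAddCircle y).integrable_comp_of_integrable
      (LpCircle.integrable f)
  have hfun : (fun t ↦ ∑ r, cellKernel M hc r * f (t + ZMod.toAddCircle r)) =
      ∑ r, fun t ↦ cellKernel M hc r * f (t + ZMod.toAddCircle r) := by
    ext t; simp
  rw [hfun, fourierCoeff.sum _ _ fun r _ ↦ (hi _).const_mul _, Finset.sum_apply, cellSymbol,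
    Finset.sum_mul]
  refine Finset.sum_congr rfl fun r _ ↦ ?_
  rw [fourierCoeff.const_mul, mul_assoc]
  congr 1
  rw [fourierCoeff, fourierCoeff, ← integral_const_mul, ← integral_add_right_eq_self
    (fun t ↦ fourier m (ZMod.toAddCircle r : UnitAddCircle) * fourier (-m) t • f t)
    (ZMod.toAddCircle r : UnitAddCircle)]
  refine integral_congr_ae (ae_of_all _ fun t ↦ ?_)
  simp only [smul_eq_mul, ← mul_assoc]
  congr 1
  rw [fourier_apply, fourier_apply, fourier_apply, ← Circle.coe_mul, ← AddCircle.toCircle_add]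
  congr 2
  simp only [smul_add, neg_smul]
  abel

theorem coeFn_sum_smul_cellIndicator {p : ℝ≥0∞} {N : ℕ} [NeZero N] {c : UnitAddCircle → ZMod N}
    (hc : Measurable c) (a : ZMod N → ℂ) :
    (∑ j, a j • cellIndicator p hc j : LpCircle p) =ᵐ[haarAddCircle] fun x ↦ a (c x) := by
  have h : ∀ j, cellIndicator p hc j =ᵐ[haarAddCircle]
      fun x ↦ if c x = j then (1 : ℂ) else 0 := by
    intro j
    filter_upwards [indicatorConstLp_coeFn (p := p) (μ := (haarAddCircle : Measure UnitAddCircle))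
      (hs := hc (measurableSet_singleton j)) (hμs := measure_ne_top _ _) (c := (1 : ℂ))] with x hx
    refine hx.trans ?_
    by_cases h : c x = j
    · rw [if_pos h, Set.indicator_of_mem (by exact h)]
    · rw [if_neg h, Set.indicator_of_notMem (by exact h)]
  filter_upwards [LpCircle.coeFn_sum_smul a (cellIndicator p hc), ae_all_iff.2 h] with x h1 h2
  rw [h1]
  simp [h2]

/-- Convolution with the kernel as an average of `M` applied to samples. The substitution
`j = c x + r` turns the sum over `r` into a sum over cells. -/
theorem sum_cellKernel_mul (M : LpCircle p →L[ℂ] LpCircle p) (hc : Measurable c)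
    (g : UnitAddCircle → ℂ) (t : UnitAddCircle) :
    ∑ r, cellKernel M hc r * g (t + ZMod.toAddCircle r) =
      ∫ x, ∑ j, g (t - ZMod.toAddCircle (c x) + ZMod.toAddCircle j) * M (cellIndicator p hc j) x
        ∂haarAddCircle := by
  have hi : ∀ r, Integrable (fun x ↦ M (cellIndicator p hc (c x + r)) x) haarAddCircle := fun r ↦
    integrable_apply_comp_fiber hc (g := fun i x ↦ M (cellIndicator p hc (i + r)) x)
      (fun i ↦ LpCircle.measurable _) (fun i ↦ LpCircle.integrable _)
  simp_rw [cellKernel, ← integral_mul_const]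
  rw [← integral_finsetSum _ fun r _ ↦ (hi r).mul_const _]
  refine integral_congr_ae (ae_of_all _ fun x ↦ ?_)
  refine Fintype.sum_equiv (Equiv.addLeft (c x)) _ _ fun r ↦ ?_
  simp only [Equiv.coe_addLeft, map_add, mul_comm]
  congr 2
  abel

/-- The convolution operator as an average of `M` applied to samples of the translates of `f`: for
fixed `t'`, the function `x ↦ ∑ j, f (t' + j/N) * M 1_{c = j} x` is `M` of `x ↦ f (t' + c x/N)`. -/
theorem coeFn_cellConvolution_eq_integral (M : LpCircle p →L[ℂ] LpCircle p) (hc : Measurable c)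
    (f : LpCircle p) :
    cellConvolution M hc f =ᵐ[haarAddCircle] fun t ↦
      ∫ x, ∑ j, f (t - ZMod.toAddCircle (c x) + ZMod.toAddCircle j) * M (cellIndicator p hc j) x
        ∂haarAddCircle := by
  filter_upwards [coeFn_cellConvolution M hc f] with t ht
  rw [ht, sum_cellKernel_mul]

/-- Any bound for the amplification of `M` to functions with values in a finite-dimensional space
with a seminorm is inherited by the convolution operator. -/
theorem eLpNorm_seminorm_cellConvolution_le {ι : Type*} [Fintype ι] (ν : Seminorm ℂ (ι → ℂ))
    (M : LpCircle p →L[ℂ] LpCircle p) (hc : Measurable c) {C : ℝ≥0∞}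
    (hM : ∀ F : ι → LpCircle p, eLpNorm (fun t ↦ ν fun i ↦ M (F i) t) p haarAddCircle ≤
      C * eLpNorm (fun t ↦ ν fun i ↦ F i t) p haarAddCircle) (F : ι → LpCircle p) :
    eLpNorm (fun t ↦ ν fun i ↦ cellConvolution M hc (F i) t) p haarAddCircle ≤
      C * eLpNorm (fun t ↦ ν fun i ↦ F i t) p haarAddCircle := by
  have hν : Measurable ν := ν.continuous_of_finiteDimensional.measurable
  set Φ : UnitAddCircle × UnitAddCircle → ι → ℂ := fun z i ↦
    ∑ j, F i (z.1 + ZMod.toAddCircle j) * M (cellIndicator p hc j) z.2 with hΦ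
  have hΦm : Measurable Φ := by
    refine measurable_pi_lambda _ fun i ↦ Finset.measurable_fun_sum _ fun j _ ↦ ?_
    exact ((LpCircle.measurable (F i)).comp (measurable_fst.add_const _)).mul
      ((LpCircle.measurable _).comp measurable_snd)
  have hp : 1 ≤ p := Fact.out
  refine eLpNorm_le_of_translate_fiber hc ZMod.toAddCircle (zero_lt_one.trans_le hp).ne'
    (φ := fun z ↦ ν (Φ z)) (hν.comp hΦm)
    (hν.comp (measurable_pi_lambda _ fun i ↦ LpCircle.measurable (F i))) ?_ fun t ↦ ?_
  · filter_upwards [ae_all_iff.2 fun i ↦ coeFn_cellConvolution_eq_integral M hc (F i)] with t ht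
    have hG : Integrable (fun x ↦ Φ (t - ZMod.toAddCircle (c x), x)) haarAddCircle := by
      refine Integrable.of_eval fun i ↦ integrable_finsetSum _ fun j _ ↦ ?_
      exact integrable_apply_comp_fiber hc (g := fun k x ↦
        F i (t - ZMod.toAddCircle k + ZMod.toAddCircle j) * M (cellIndicator p hc j) x)
        (fun k ↦ (LpCircle.measurable _).const_mul _) (fun k ↦ (LpCircle.integrable _).const_mul _)
    have h := ν.enorm_integral_le_eLpNorm hp hG
    convert h using 3
    ext i
    rw [ht i, eval_integral fun i ↦ hG.eval i]
  · set S : ι → LpCircle p := fun i ↦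
      ∑ j, F i (t + ZMod.toAddCircle j) • cellIndicator p hc j with hS
    have h1 : (fun x ↦ ν (Φ (t, x))) =ᵐ[haarAddCircle] fun x ↦ ν fun i ↦ M (S i) x := by
      have h : ∀ i, M (S i) =ᵐ[haarAddCircle] fun x ↦ Φ (t, x) i := by
        intro i
        simp only [hS, map_sum, map_smul]
        exact LpCircle.coeFn_sum_smul _ _
      filter_upwards [ae_all_iff.2 h] with x hx
      congr 1
      ext i
      rw [hx i]
    have h2 : (fun x ↦ ν fun i ↦ S i x) =ᵐ[haarAddCircle]
        fun x ↦ ν fun i ↦ F i (t + ZMod.toAddCircle (c x)) := by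
      filter_upwards [ae_all_iff.2 fun i ↦ coeFn_sum_smul_cellIndicator (p := p) hc
        fun j ↦ F i (t + ZMod.toAddCircle j)] with x hx
      congr 1
      ext i
      exact hx i
    calc eLpNorm (fun x ↦ ν (Φ (t, x))) p haarAddCircle
        = eLpNorm (fun x ↦ ν fun i ↦ M (S i) x) p haarAddCircle := eLpNorm_congr_ae h1
      _ ≤ C * eLpNorm (fun x ↦ ν fun i ↦ S i x) p haarAddCircle := hM S
      _ = _ := by rw [eLpNorm_congr_ae h2]; rfl

theorem norm_cellConvolution_le (M : LpCircle p →L[ℂ] LpCircle p) (hc : Measurable c) :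
    ‖cellConvolution M hc‖ ≤ ‖M‖ := by
  have hunit : ∀ f : LpCircle p,
      eLpNorm (fun t ↦ normSeminorm ℂ (Unit → ℂ) fun _ ↦ f t) p haarAddCircle = ‖f‖ₑ := by
    intro f
    rw [Lp.enorm_def]
    refine eLpNorm_congr_norm_ae (ae_of_all _ fun t ↦ ?_)
    simp
  refine ContinuousLinearMap.opNorm_le_bound _ (norm_nonneg _) fun f ↦ ?_
  have h := eLpNorm_seminorm_cellConvolution_le (normSeminorm ℂ (Unit → ℂ)) M hc
    (C := ‖M‖ₑ) (fun F ↦ ?_) (fun _ ↦ f)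
  · rw [hunit, hunit, ← enorm_norm M, ← enorm_norm f, ← enorm_mul] at h
    have h' := (enorm_le_iff_norm_le.1 h)
    simpa using h'
  · have h1 := hunit (M (F ()))
    have h2 := hunit (F ())
    have h3 : ‖M (F ())‖ₑ ≤ ‖M‖ₑ * ‖F ()‖ₑ := M.le_opENorm _
    rw [← h1, ← h2] at h3
    exact h3

theorem cbNorm_cellConvolution_le (M : LpCircle p →L[ℂ] LpCircle p) (hc : Measurable c) :
    cbNorm (cellConvolution M hc) ≤ cbNorm M := by
  refine iSup_mono fun k ↦ sInf_le_sInf fun C hC F ↦ ?_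
  exact eLpNorm_seminorm_cellConvolution_le ((schattenSeminorm p k).comp
    (LinearEquiv.curry ℂ ℂ (Fin k) (Fin k)).toLinearMap) M hc
    (fun F ↦ hC (Matrix.of fun i j ↦ F (i, j))) (fun ij ↦ F ij.1 ij.2)

end Transference

/-! ### Convergence of the multipliers -/

section Convergence

variable {p : ℝ≥0∞} [Fact (1 ≤ p)] {N : ℕ} [NeZero N] {c : UnitAddCircle → ZMod N}

theorem LpCircle.integral_norm_le (f : LpCircle p) : ∫ x, ‖f x‖ ∂haarAddCircle ≤ ‖f‖ := by
  rw [integral_norm_eq_lintegral_enorm (Lp.aestronglyMeasurable f),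
    ← eLpNorm_one_eq_lintegral_enorm,
    Lp.norm_def]
  exact ENNReal.toReal_mono (Lp.eLpNorm_ne_top f)
    (eLpNorm_le_eLpNorm_of_exponent_le Fact.out (Lp.aestronglyMeasurable f))

/-- The step function `x ↦ exp (2 π i m c(x)/N)`, a discretisation of the character `fourier m`. -/
noncomputable def cellFourier (p : ℝ≥0∞) (hc : Measurable c) (m : ℤ) : LpCircle p :=
  ∑ j, fourier m (ZMod.toAddCircle j : UnitAddCircle) • cellIndicator p hc j

theorem coeFn_cellFourier {p : ℝ≥0∞} {N : ℕ} [NeZero N] {c : UnitAddCircle → ZMod N}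
    (hc : Measurable c) (m : ℤ) : cellFourier p hc m =ᵐ[haarAddCircle]
      fun x ↦ fourier m (ZMod.toAddCircle (c x) : UnitAddCircle) :=
  coeFn_sum_smul_cellIndicator hc _

theorem norm_fourier_apply (m : ℤ) (x : UnitAddCircle) : ‖fourier m x‖ = 1 := by
  rw [fourier_apply, Circle.norm_coe]

theorem norm_cellFourier_le {p : ℝ≥0∞} {N : ℕ} [NeZero N] {c : UnitAddCircle → ZMod N}
    (hc : Measurable c) (m : ℤ) : ‖cellFourier p hc m‖ ≤ 1 := by
  refine (Lp.norm_le_of_ae_bound zero_le_one ?_).trans (b := _) ?_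
  · filter_upwards [coeFn_cellFourier (p := p) hc m] with x hx
    rw [hx, norm_fourier_apply]
  · simp [measureUnivNNReal]

/-- The value of the discretised multiplier at `m` is the matrix coefficient of `M` at the
discretised character. -/
theorem cellSymbol_eq_integral (M : LpCircle p →L[ℂ] LpCircle p) (hc : Measurable c) (m : ℤ) :
    cellSymbol M hc m =
      ∫ x, fourier (-m) (ZMod.toAddCircle (c x) : UnitAddCircle) * M (cellFourier p hc m) x
        ∂haarAddCircle := by
  have h := sum_cellKernel_mul M hc (fourier m) 0
  simp only [zero_add, zero_sub] at h
  rw [cellSymbol, h]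
  have h1 : M (cellFourier p hc m) =ᵐ[haarAddCircle] fun x ↦
      ∑ j : ZMod N, fourier m (ZMod.toAddCircle j : UnitAddCircle) *
        M (cellIndicator p hc j) x := by
    simp only [cellFourier, map_sum, map_smul]
    exact LpCircle.coeFn_sum_smul _ _
  refine integral_congr_ae ?_
  filter_upwards [h1] with x hx
  rw [hx, Finset.mul_sum]
  refine Finset.sum_congr rfl fun j _ ↦ ?_
  rw [← mul_assoc]
  congr 1
  rw [fourier_apply, fourier_apply, fourier_apply, ← Circle.coe_mul, ← AddCircle.toCircle_add]
  simp

/-- The error comes from replacing the step function by the character, once on each side of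
`∫ s̄ M s`. -/
theorem norm_cellSymbol_sub_le {φ : ℤ → ℂ} {M : LpCircle p →L[ℂ] LpCircle p}
    (hM : IsFourierMultiplier φ M) (hc : Measurable c) {m : ℤ} {ε : ℝ}
    (hε : ∀ x, ‖fourier m (ZMod.toAddCircle (c x) : UnitAddCircle) - fourier m x‖ ≤ ε) :
    ‖cellSymbol M hc m - φ m‖ ≤ ε * (‖M‖ + ‖φ m‖) := by
  have hε0 : 0 ≤ ε := (norm_nonneg _).trans (hε 0)
  have hε' : ∀ x,
      ‖fourier (-m) (ZMod.toAddCircle (c x) : UnitAddCircle) - fourier (-m) x‖ ≤ ε := by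
    intro x
    rw [fourier_neg, fourier_neg, ← map_sub, Complex.norm_conj]
    exact hε x
  set s := cellFourier p hc m with hs
  have hi1 : Integrable (fun x ↦ fourier (-m) x * M s x) haarAddCircle :=
    (LpCircle.integrable (M s)).fourier_smul (-m)
  have hi2 : Integrable (fun x ↦ fourier (-m) x * s x) haarAddCircle :=
    (LpCircle.integrable s).fourier_smul (-m)
  have hθ : Measurable fun x ↦ fourier (-m) (ZMod.toAddCircle (c x) : UnitAddCircle) :=
    (measurable_of_countable fun j : ZMod N ↦
      fourier (-m) (ZMod.toAddCircle j : UnitAddCircle)).comp hc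
  have hi3 : Integrable (fun x ↦ fourier (-m) (ZMod.toAddCircle (c x) : UnitAddCircle) * M s x)
      haarAddCircle :=
    (LpCircle.integrable (M s)).bdd_mul (c := 1) hθ.aestronglyMeasurable
      (ae_of_all _ fun x ↦ (norm_fourier_apply _ _).le)
  have h1 : ‖cellSymbol M hc m - fourierCoeff (M s) m‖ ≤ ε * ‖M‖ := by
    rw [cellSymbol_eq_integral, fourierCoeff]
    simp only [smul_eq_mul]
    rw [← integral_sub hi3 hi1]
    calc _ ≤ ∫ x, ε * ‖M s x‖ ∂haarAddCircle := by
          refine norm_integral_le_of_norm_le ((LpCircle.integrable (M s)).norm.const_mul ε)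
            (ae_of_all _ fun x ↦ ?_)
          rw [← sub_mul, norm_mul]
          exact mul_le_mul_of_nonneg_right (hε' x) (norm_nonneg _)
      _ ≤ ε * ‖M‖ := by
          rw [integral_const_mul]
          gcongr
          exact (LpCircle.integral_norm_le _).trans
            ((M.le_opNorm s).trans (mul_le_of_le_one_right (norm_nonneg _)
              (norm_cellFourier_le hc m)))
  have h2 : ‖fourierCoeff s m - 1‖ ≤ ε := by
    have : (1 : ℂ) = ∫ x : UnitAddCircle, 1 ∂haarAddCircle := by simp
    rw [this, fourierCoeff]
    simp only [smul_eq_mul]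
    rw [← integral_sub hi2 (integrable_const _)]
    have h : ∀ᵐ x ∂(haarAddCircle : Measure UnitAddCircle), ‖fourier (-m) x * s x - 1‖ ≤ ε := by
      filter_upwards [coeFn_cellFourier (p := p) hc m] with x hx
      have h3 : (1 : ℂ) = fourier (-m) x * fourier m x := by
        rw [← fourier_add]; simp
      rw [h3, hx, ← mul_sub, norm_mul, norm_fourier_apply, one_mul]
      exact hε x
    simpa using norm_integral_le_of_norm_le_const h
  calc ‖cellSymbol M hc m - φ m‖
      = ‖(cellSymbol M hc m - fourierCoeff (M s) m) + φ m * (fourierCoeff s m - 1)‖ := by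
        rw [hM s m]; ring_nf
    _ ≤ ε * ‖M‖ + ‖φ m‖ * ε := by
        refine (norm_add_le _ _).trans (add_le_add h1 ?_)
        rw [norm_mul]
        gcongr
    _ = _ := by ring

/-- The index `⌊N y⌋` of the arc `[j/N, (j+1)/N)` that contains `x`, where `y` is the
representative of `x` in `[0, 1)`. -/
noncomputable def arcIndex (N : ℕ) (x : UnitAddCircle) : ZMod N :=
  (⌊(N : ℝ) * (measurableEquivIco 1 0 x : ℝ)⌋ : ℤ)

theorem measurable_arcIndex (N : ℕ) : Measurable (arcIndex N) := by
  have h : Measurable fun x : UnitAddCircle ↦ (N : ℝ) * (measurableEquivIco 1 0 x : ℝ) :=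
    (measurable_subtype_coe.comp (measurableEquivIco (1 : ℝ) 0).measurable).const_mul _
  exact (measurable_of_countable fun j : ℤ ↦ (j : ZMod N)).comp (Int.measurable_floor.comp h)

theorem norm_fourier_arcIndex_sub_le (N : ℕ) [NeZero N] (m : ℤ) (x : UnitAddCircle) :
    ‖fourier m (ZMod.toAddCircle (arcIndex N x) : UnitAddCircle) - fourier m x‖ ≤
      2 * Real.pi * |(m : ℝ)| / N := by
  have hN : (0 : ℝ) < N := by exact_mod_cast Nat.pos_of_ne_zero (NeZero.ne N)
  set y : ℝ := (measurableEquivIco 1 0 x : ℝ) with hy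
  have hx : x = (y : UnitAddCircle) := ((measurableEquivIco (1 : ℝ) 0).symm_apply_apply x).symm
  rw [arcIndex, ← hy, ZMod.toAddCircle_intCast]
  set a : ℝ := (⌊(N : ℝ) * y⌋ : ℝ) / N with ha
  have hay : |a - y| ≤ 1 / N := by
    have h1 := Int.floor_le ((N : ℝ) * y)
    have h2 := Int.lt_floor_add_one ((N : ℝ) * y)
    rw [abs_le, ha]
    constructor
    · rw [le_sub_iff_add_le, le_div_iff₀ hN]
      field_simp
      linarith
    · have : (⌊(N : ℝ) * y⌋ : ℝ) / N ≤ y := by rw [div_le_iff₀ hN]; linarith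
      have : 0 < 1 / (N : ℝ) := by positivity
      linarith
  rw [hx, fourier_coe_apply, fourier_coe_apply]
  have h3 : Complex.exp (2 * Real.pi * Complex.I * m * a / (1 : ℝ)) -
      Complex.exp (2 * Real.pi * Complex.I * m * y / (1 : ℝ)) =
      Complex.exp ((2 * Real.pi * m * y : ℝ) * Complex.I) *
        (Complex.exp (Complex.I * (2 * Real.pi * m * (a - y) : ℝ)) - 1) := by
    rw [mul_sub, ← Complex.exp_add, mul_one]
    congr 2 <;> (push_cast; ring)
  rw [h3, norm_mul, Complex.norm_exp_ofReal_mul_I, one_mul]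
  refine (Real.norm_exp_I_mul_ofReal_sub_one_le).trans ?_
  rw [Real.norm_eq_abs, abs_mul, abs_mul, abs_of_pos Real.two_pi_pos]
  calc 2 * Real.pi * |(m : ℝ)| * |a - y| ≤ 2 * Real.pi * |(m : ℝ)| * (1 / N) := by gcongr
    _ = _ := by ring

end Convergence

theorem mainTheorem5 (p : ℝ≥0∞) [Fact (1 ≤ p)] (φ : ℤ → ℂ)
    (M : LpCircle p →L[ℂ] LpCircle p) (hM : IsFourierMultiplier φ M) :
    ∃ (ψ : ℕ → ℤ → ℂ) (T : ℕ → LpCircle p →L[ℂ] LpCircle p),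
      (∀ n, ∃ N : ℕ, 0 < N ∧ Function.Periodic (ψ n) (N : ℤ)) ∧
      (∀ n, IsFourierMultiplier (ψ n) (T n)) ∧
      (∀ m : ℤ, Tendsto (fun n ↦ ψ n m) atTop (𝓝 (φ m))) ∧
      (∀ n, ‖T n‖ ≤ ‖M‖) ∧
      (∀ n, cbNorm (T n) ≤ cbNorm M) := by
  refine ⟨fun n ↦ cellSymbol M (measurable_arcIndex (n + 1)),
    fun n ↦ cellConvolution M (measurable_arcIndex (n + 1)),
    fun n ↦ ⟨n + 1, n.succ_pos, cellSymbol_periodic M _⟩,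
    fun n ↦ isFourierMultiplier_cellConvolution M _, fun m ↦ ?_,
    fun n ↦ norm_cellConvolution_le M _, fun n ↦ cbNorm_cellConvolution_le M _⟩
  rw [tendsto_iff_norm_sub_tendsto_zero]
  refine squeeze_zero (fun n ↦ norm_nonneg _) (fun n ↦ norm_cellSymbol_sub_le hM
    (measurable_arcIndex (n + 1)) (norm_fourier_arcIndex_sub_le (n + 1) m)) ?_
  have h : Tendsto (fun n : ℕ ↦ 2 * Real.pi * |(m : ℝ)| / ((n + 1 : ℕ) : ℝ)) atTop (𝓝 0) :=
    (tendsto_const_div_atTop_nhds_zero_nat _).comp (tendsto_add_atTop_nat 1)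
  simpa using h.mul_const (‖M‖ + ‖φ m‖)
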